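/- Definitions. A function $f$ on a real interval $I$ is called complex analytic in $I$ if it is the restriction to $I$ of a complex-valued function $f(z)$ that is analytic in a complex neighbourhood of $I$. For $I=[0,a]$ with $0<a<\infty$, or $I=[0,\infty)$ if $a=\infty$, let $\rho_0\in(0,\infty]$ be the distance from the origin of the singularity of $f(z)$ nearest to the origin, i.e. the supremum of the $r$ for which the extension from $I$ is analytic also in the disc $|z|<r$ ($\rho_0=\infty$ if $f(z)$ is entire). For $0<\omega<a<\infty$ put $$\mathrm{PV}\!\int_0^a \frac{f(x)}{\omega-x}\,dx=\lim_{\delta\to0^+}\Big(\int_0^{\omega-\delta}+\int_{\omega+\delta}^a\Big)\frac{f(x)}{\omega-x}\,dx ,\qquad \mathrm{PV}\!\int_0^\infty=\lim_{a\to\infty}\mathrm{PV}\!\int_0^a .$$ The finite part $\mathrm{FP}\!\!\int_0^a h(x)\,dx$ ($0<a<\infty$) is $\lim_{\varepsilon\to0^+}C_\varepsilon$, where $\int_\varepsilon^a h(x)\,dx=C_\varepsilon+D_\varepsilon$ for $0<\varepsilon<a$, $D_\varepsilon$ is a finite linear combination of diverging powers $\varepsilon^{-s}$ ($s>0$) and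 of $\ln\varepsilon$, and $C_\varepsilon$ converges; and $\mathrm{FP}\!\!\int_0^\infty h(x)\,dx=\lim_{a\to\infty}\mathrm{FP}\!\!\int_0^a h(x)\,dx$. Theorem. Let $0<a<\infty$, let $f$ be complex analytic in $[0,a]$ and let $0<\omega<\min(a,\rho_0)$. (1) If $f(0)\ne0$, then $$\mathrm{PV}\!\int_0^a \frac{f(x)}{\omega-x}\,dx=-\sum_{k=0}^\infty \omega^k\,\mathrm{FP}\!\!\int_0^a\frac{f(x)}{x^{k+1}}\,dx+f(\omega)\ln\omega .$$ (2) If $f$ has a zero of order $m\ge1$ at the origin, $f(x)=x^m g(x)$ with $g$ complex analytic in $[0,a]$ and $g(0)\neq0$, then $$\mathrm{PV}\!\int_0^a \frac{f(x)}{\omega-x}\,dx=-\sum_{k=0}^{m-1}\omega^k\int_0^a x^{m-k-1}g(x)\,dx-\sum_{k=0}^\infty \omega^{m+k}\,\mathrm{FP}\!\!\int_0^a\frac{g(x)}{x^{k+1}}\,dx+\omega^m g(\omega)\ln\omega .$$ (3) Let $f$ (and, in the second formula, $g$) be complex analytic in $[0,\infty)$, and let $0<\omega<\rho_0$, or let $f(z)$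 be entire and $\omega>0$ arbitrary. If $\mathrm{PV}\int_0^\infty \frac{f(x)}{\omega-x}\,dx$ exists, then the formulas of (1) and (2), under the same conditions on $f(0)$, respectively on $m$ and $g$, hold with $a=\infty$, where the integrals $\int_0^\infty x^{m-k-1}g(x)\,dx$ are the improper integrals $\lim_{a\to\infty}\int_0^a x^{m-k-1}g(x)\,dx$. In all cases the principal value, the finite parts, the (improper) integrals and the sum of the series in the formula exist. -/

import Mathlib

open Filter Topology MeasureTheory

noncomputable section

namespace FinitePart

/-- `F` is a complex extension of `f`: it agrees with `f` on the real set `I`. -/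
def Extends (F : ℂ → ℂ) (f : ℝ → ℂ) (I : Set ℝ) : Prop :=
  ∀ x ∈ I, F (x : ℂ) = f x

/-- `f` is complex analytic in the real set `I`: it is the restriction to `I` of a function of a
complex variable that is analytic at (hence in a complex neighbourhood of) every point of `I`. -/
def ComplexAnalytic (f : ℝ → ℂ) (I : Set ℝ) : Prop :=
  ∃ F : ℂ → ℂ, AnalyticOnNhd ℂ F ((fun x : ℝ => (x : ℂ)) '' I) ∧ Extends F f I

/-- `f`, given on `I`, has an entire complex extension. -/
def ExtendsToEntire (f : ℝ → ℂ) (I : Set ℝ) : Prop :=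
  ∃ F : ℂ → ℂ, AnalyticOnNhd ℂ F Set.univ ∧ Extends F f I

/-- `ρ₀`, the distance from the origin of the nearest singularity of the complex extension of `f`:
the supremum of the radii `r` for which the extension of `f` from `I` is analytic in the open disc
`|z| < r` (besides being analytic on `I`). It is `⊤` when the extension is entire. -/
def singularityDistance (f : ℝ → ℂ) (I : Set ℝ) : ENNReal :=
  sSup {r : ENNReal | ∃ F : ℂ → ℂ,
    AnalyticOnNhd ℂ F ({z : ℂ | ENNReal.ofReal ‖z‖ < r} ∪ (fun x : ℝ => (x : ℂ)) '' I) ∧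
    Extends F f I}

/-- The Cauchy principal value of `∫₀ᵃ h(x) dx`, `0 < ω < a`, with singular point `ω`, exists and
equals `L`. -/
def HasPV (h : ℝ → ℂ) (ω a : ℝ) (L : ℂ) : Prop :=
  (∀ δ : ℝ, 0 < δ → δ < min ω (a - ω) →
    IntervalIntegrable h volume 0 (ω - δ) ∧ IntervalIntegrable h volume (ω + δ) a) ∧
  Tendsto (fun δ : ℝ => (∫ x in (0 : ℝ)..(ω - δ), h x) + ∫ x in (ω + δ)..a, h x)
    (𝓝[>] 0) (𝓝 L)

/-- The principal value of `∫₀^∞ h(x) dx` with singular point `ω`: the principal values over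
`[0, a]` have the limit `L` as `a → ∞`. -/
def HasPVTop (h : ℝ → ℂ) (ω : ℝ) (L : ℂ) : Prop :=
  ∃ P : ℝ → ℂ, (∀ a : ℝ, ω < a → HasPV h ω a (P a)) ∧ Tendsto P atTop (𝓝 L)

/-- A finite combination `∑ₛ cₛ ε⁻ˢ + d ln ε` of diverging algebraic powers of `ε` and of `ln ε`
(used with all exponents `s` in the support of `c` positive). -/
def divergentPart (c : ℝ →₀ ℂ) (d : ℂ) (ε : ℝ) : ℂ :=
  c.sum (fun s b => b * ((ε ^ (-s) : ℝ) : ℂ)) + d * (Real.log ε : ℂ)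

/-- The Hadamard finite part of `∫₀ᵃ h(x) dx` (divergent at `0`) exists and equals `L`:
`∫_ε^a h(x) dx = C_ε + D_ε`, where `D_ε` consists of diverging algebraic powers of `ε` and of
`ln ε` only, and `C_ε → L` as `ε → 0⁺`. -/
def HasFinitePart (h : ℝ → ℂ) (a : ℝ) (L : ℂ) : Prop :=
  ∃ (C : ℝ → ℂ) (c : ℝ →₀ ℂ) (d : ℂ),
    (∀ s ∈ c.support, 0 < s) ∧
    (∀ ε : ℝ, 0 < ε → ε < a →
      IntervalIntegrable h volume ε a ∧ ∫ x in ε..a, h x = C ε + divergentPart c d ε) ∧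
    Tendsto C (𝓝[>] 0) (𝓝 L)

/-- The finite part of `∫₀^∞ h(x) dx`: the limit, as `a → ∞`, of the finite parts over `[0, a]`. -/
def HasFinitePartTop (h : ℝ → ℂ) (L : ℂ) : Prop :=
  ∃ P : ℝ → ℂ, (∀ a : ℝ, 0 < a → HasFinitePart h a (P a)) ∧ Tendsto P atTop (𝓝 L)

/-- A combination of diverging terms that converges has the limit `0`. -/
theorem divergentPart_limit (c : ℝ →₀ ℂ) (hc : ∀ s ∈ c.support, 0 < s) (d L : ℂ)
    (h : Tendsto (divergentPart c d) (𝓝[>] 0) (𝓝 L)) : L = 0 := by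
  have h1 : c = 0 := by
    by_contra hne
    have hs : c.support.Nonempty := Finsupp.support_nonempty_iff.2 hne
    set M := c.support.max' hs with hM
    have hMm : M ∈ c.support := Finset.max'_mem _ _
    have hM0 : 0 < M := hc M hMm
    have hpow : ∀ r : ℝ, 0 < r → Tendsto (fun ε : ℝ => ((ε ^ r : ℝ) : ℂ)) (𝓝[>] 0) (𝓝 0) := by
      intro r hr
      have : Tendsto (fun ε : ℝ => ε ^ r) (𝓝[>] 0) (𝓝 0) := by
        have := (Real.continuousAt_rpow_const 0 r (Or.inr hr.le)).tendsto
        rw [Real.zero_rpow hr.ne'] at this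
        exact this.mono_left nhdsWithin_le_nhds
      exact_mod_cast (Complex.continuous_ofReal.tendsto (0:ℝ)).comp this
    have hA : Tendsto (fun ε : ℝ => ((ε ^ M : ℝ) : ℂ) * divergentPart c d ε) (𝓝[>] 0) (𝓝 0) := by
      simpa using (hpow M hM0).mul h
    have hlog : Tendsto (fun ε : ℝ => ((Real.log ε * ε ^ M : ℝ) : ℂ)) (𝓝[>] 0) (𝓝 0) := by
      have := tendsto_log_mul_rpow_nhdsGT_zero hM0
      exact_mod_cast (Complex.continuous_ofReal.tendsto (0:ℝ)).comp this
    have hB : Tendsto (fun ε : ℝ => (∑ s ∈ c.support, c s * ((ε ^ (M - s) : ℝ) : ℂ))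
        + d * ((Real.log ε * ε ^ M : ℝ) : ℂ)) (𝓝[>] 0)
        (𝓝 ((∑ s ∈ c.support, c s * (if s = M then 1 else 0)) + d * 0)) := by
      refine Tendsto.add (tendsto_finsetSum _ fun s hs' => ?_) (hlog.const_mul d)
      refine Tendsto.const_mul _ ?_
      split_ifs with hsM
      · subst hsM; simp
      · exact hpow _ (sub_pos.2 (lt_of_le_of_ne (Finset.le_max' _ _ hs') hsM))
    have hE : (fun ε : ℝ => ((ε ^ M : ℝ) : ℂ) * divergentPart c d ε) =ᶠ[𝓝[>] 0]
        (fun ε : ℝ => (∑ s ∈ c.support, c s * ((ε ^ (M - s) : ℝ) : ℂ))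
        + d * ((Real.log ε * ε ^ M : ℝ) : ℂ)) := by
      filter_upwards [self_mem_nhdsWithin] with ε hε
      have hε : 0 < ε := hε
      simp only [divergentPart, Finsupp.sum, mul_add, Finset.mul_sum]
      congr 1
      · refine Finset.sum_congr rfl fun s _ => ?_
        rw [sub_eq_add_neg, Real.rpow_add hε]; push_cast; ring
      · push_cast; ring
    have := tendsto_nhds_unique hA (hB.congr' hE.symm)
    simp [Finset.sum_ite_eq'] at this
    simp only [Finsupp.mem_support_iff] at hMm
    exact hMm (by by_contra hh; exact hh (this hh).symm)
  subst h1
  have hd : d = 0 := by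
    by_contra hd
    have h2 : Tendsto (fun ε : ℝ => (Real.log ε : ℂ)) (𝓝[>] 0) (𝓝 (d⁻¹ * L)) := by
      refine (h.const_mul d⁻¹).congr fun ε => ?_
      simp [divergentPart, hd]
    have h3 := (Complex.continuous_re.tendsto _).comp h2
    exact not_tendsto_nhds_of_tendsto_atBot Real.tendsto_log_nhdsGT_zero _ h3
  subst hd
  have : divergentPart 0 0 = fun _ => 0 := by ext; simp [divergentPart]
  rw [this] at h
  exact (tendsto_nhds_unique h tendsto_const_nhds)

/-- The finite part is unique. -/
theorem HasFinitePart.unique {h : ℝ → ℂ} {a : ℝ} (ha : 0 < a) {L₁ L₂ : ℂ}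
    (h₁ : HasFinitePart h a L₁) (h₂ : HasFinitePart h a L₂) : L₁ = L₂ := by
  obtain ⟨C₁, c₁, d₁, p₁, e₁, t₁⟩ := h₁
  obtain ⟨C₂, c₂, d₂, p₂, e₂, t₂⟩ := h₂
  have key : Tendsto (divergentPart (c₂ - c₁) (d₂ - d₁)) (𝓝[>] 0) (𝓝 (L₁ - L₂)) := by
    refine (t₁.sub t₂).congr' ?_
    filter_upwards [Ioo_mem_nhdsGT ha] with ε hε
    have := (e₁ ε hε.1 hε.2).2.symm.trans (e₂ ε hε.1 hε.2).2
    have hs : divergentPart (c₂ - c₁) (d₂ - d₁) ε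
        = divergentPart c₂ d₂ ε - divergentPart c₁ d₁ ε := by
      simp only [divergentPart]
      rw [Finsupp.sum_sub_index (fun s b₁ b₂ => by ring)]
      ring
    rw [hs]
    linear_combination this
  refine sub_eq_zero.1 (divergentPart_limit _ (fun s hs => ?_) _ _ key)
  have := Finsupp.support_sub hs
  rcases Finset.mem_union.1 this with h | h
  · exact p₂ s h
  · exact p₁ s h

/-- The finite part over `[0, ∞)` is unique. -/
theorem HasFinitePartTop.unique {h : ℝ → ℂ} {L₁ L₂ : ℂ}
    (h₁ : HasFinitePartTop h L₁) (h₂ : HasFinitePartTop h L₂) : L₁ = L₂ := by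
  obtain ⟨P₁, p₁, t₁⟩ := h₁
  obtain ⟨P₂, p₂, t₂⟩ := h₂
  refine tendsto_nhds_unique t₁ (t₂.congr' ?_)
  filter_upwards [eventually_gt_atTop 0] with a ha
  exact (p₂ a ha).unique ha (p₁ a ha)

/-- The integral `∫₀^∞ h(x) dx` converges, as an improper integral at `∞`, to `L`. -/
def HasImproperIntegral (h : ℝ → ℂ) (L : ℂ) : Prop :=
  (∀ a : ℝ, 0 < a → IntervalIntegrable h volume 0 a) ∧
  Tendsto (fun a : ℝ => ∫ x in (0 : ℝ)..a, h x) atTop (𝓝 L)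

end FinitePart

end

/-!
The proof is a telescoping argument on the real line. Analyticity enters only through the fact that
`f` and its difference quotient at `ω` have power series at `0` converging beyond `ω`.

*Finite interval.* Write `f(x) = f(ω) + (x - ω) G(x)`; the quotient `G` is analytic where `f` is.
With `ψ k` the finite part of `∫₀ᵃ G(x) x^{-k} dx` (`ψ 0` being the ordinary integral of `G`),
linearity gives
`FP ∫₀ᵃ f(x) x^{-(k+1)} dx = f(ω) FP ∫₀ᵃ x^{-(k+1)} dx + ψ k - ω ψ (k + 1)`.
After multiplication by `ω^k` the last two terms telescope to `ψ 0`, because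
`ψ (k + 1) = O(σ^{-k})` for some `σ > ω` (`exists_finitePart_of_series_of_continuousOn`), and the
first one sums to `f(ω) log (a - ω)`, a logarithmic series. On the other side, the principal value
is `f(ω) (log ω - log (a - ω)) - ∫₀ᵃ G`. This is `AnalyticOnDisc.exists_expansion`.

*Zero at the origin.* A factor `x^m` is exchanged for `ω^m` by
`x^m = ω^m - (ω - x) ∑_{k<m} ω^k x^{m-1-k}` (`HasPV.pow_mul`), and `g` is analytic in the same disc
as `f` (`AnalyticOnDisc.of_mul_pow`).

*Half-line.* Fix `b > ω`. Existence of the principal value means that `∫_b^∞ h` converges for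
`h(x) = f(x) / (x - ω)`. Integration by parts shows that `θ k = ∫_b^∞ h(x) x^{-k} dx` converges and
is `O(b^{-k})` (`exists_tendsto_integral_div_pow`). The tail of the `k`-th finite part is
`∫_b^∞ f(x) x^{-(k+1)} dx = θ k - ω θ (k + 1)`, so the tails telescope to `θ 0`, which is, up to
sign, what the principal value over `[0, b]` misses. The same tails give the improper integrals of
`x^{m-k-1} g(x) = f(x) x^{-(k+1)}` and the principal value of `g`.
-/

noncomputable section

namespace FinitePart

/-! ### Calculus of finite parts -/

/-- The finite part is the limit of the integral over `[ε, a]` after subtraction of the diverging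
terms. -/
theorem hasFinitePart_iff {h : ℝ → ℂ} {a : ℝ} (ha : 0 < a) {L : ℂ} :
    HasFinitePart h a L ↔
      (∀ ε : ℝ, 0 < ε → ε < a → IntervalIntegrable h volume ε a) ∧
      ∃ (c : ℝ →₀ ℂ) (d : ℂ), (∀ s ∈ c.support, 0 < s) ∧
        Tendsto (fun ε => (∫ x in ε..a, h x) - divergentPart c d ε) (𝓝[>] 0) (𝓝 L) := by
  constructor
  · rintro ⟨C, c, d, hc, hi, ht⟩
    refine ⟨fun ε h0 h1 => (hi ε h0 h1).1, c, d, hc, ht.congr' ?_⟩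
    filter_upwards [Ioo_mem_nhdsGT ha] with ε hε
    rw [(hi ε hε.1 hε.2).2, add_sub_cancel_right]
  · rintro ⟨hi, c, d, hc, ht⟩
    exact ⟨_, c, d, hc, fun ε h0 h1 => ⟨hi ε h0 h1, (sub_add_cancel _ _).symm⟩, ht⟩

theorem divergentPart_add (c₁ c₂ : ℝ →₀ ℂ) (d₁ d₂ : ℂ) (ε : ℝ) :
    divergentPart (c₁ + c₂) (d₁ + d₂) ε = divergentPart c₁ d₁ ε + divergentPart c₂ d₂ ε := by
  simp only [divergentPart]
  rw [Finsupp.sum_add_index' (by simp) (fun s b₁ b₂ => by ring)]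
  ring

theorem divergentPart_smul (b : ℂ) (c : ℝ →₀ ℂ) (d : ℂ) (ε : ℝ) :
    divergentPart (b • c) (b * d) ε = b * divergentPart c d ε := by
  simp only [divergentPart]
  rw [Finsupp.sum_smul_index (by simp), mul_add, Finsupp.mul_sum]
  simp only [mul_assoc]

variable {h h₁ h₂ : ℝ → ℂ} {a b : ℝ} {L L₁ L₂ : ℂ}

theorem HasFinitePart.add (ha : 0 < a) (H₁ : HasFinitePart h₁ a L₁) (H₂ : HasFinitePart h₂ a L₂) :
    HasFinitePart (fun x => h₁ x + h₂ x) a (L₁ + L₂) := by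
  rw [hasFinitePart_iff ha] at *
  obtain ⟨i₁, c₁, d₁, p₁, t₁⟩ := H₁
  obtain ⟨i₂, c₂, d₂, p₂, t₂⟩ := H₂
  refine ⟨fun ε h0 h1 => (i₁ ε h0 h1).add (i₂ ε h0 h1), c₁ + c₂, d₁ + d₂, fun s hs => ?_,
    (t₁.add t₂).congr' ?_⟩
  · rcases Finset.mem_union.1 (Finsupp.support_add hs) with h | h
    · exact p₁ s h
    · exact p₂ s h
  · filter_upwards [Ioo_mem_nhdsGT ha] with ε hε
    rw [divergentPart_add,
      intervalIntegral.integral_add (i₁ ε hε.1 hε.2) (i₂ ε hε.1 hε.2)]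
    ring

theorem HasFinitePart.const_mul (ha : 0 < a) (b : ℂ) (H : HasFinitePart h a L) :
    HasFinitePart (fun x => b * h x) a (b * L) := by
  rw [hasFinitePart_iff ha] at *
  obtain ⟨i, c, d, p, t⟩ := H
  refine ⟨fun ε h0 h1 => (i ε h0 h1).const_mul b, b • c, b * d,
    fun s hs => p s (Finsupp.support_smul hs), (t.const_mul b).congr fun ε => ?_⟩
  rw [divergentPart_smul, intervalIntegral.integral_const_mul, mul_sub]

theorem HasFinitePart.congr (ha : 0 < a) (H : HasFinitePart h₁ a L)
    (he : ∀ x ∈ Set.Ioc 0 a, h₁ x = h₂ x) : HasFinitePart h₂ a L := by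
  rw [hasFinitePart_iff ha] at *
  obtain ⟨i, c, d, p, t⟩ := H
  have he' : ∀ ε, 0 < ε → ε < a → ∀ x ∈ Set.uIoc ε a, h₁ x = h₂ x := by
    intro ε h0 h1 x hx
    rw [Set.uIoc_of_le h1.le] at hx
    exact he x ⟨h0.trans hx.1, hx.2⟩
  refine ⟨fun ε h0 h1 => (i ε h0 h1).congr (he' ε h0 h1), c, d, p, t.congr' ?_⟩
  filter_upwards [Ioo_mem_nhdsGT ha] with ε hε
  rw [intervalIntegral.integral_congr_ae (Eventually.of_forall (he' ε hε.1 hε.2))]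

theorem HasFinitePart.sum (ha : 0 < a) {ι : Type*} (s : Finset ι) {H : ι → ℝ → ℂ} {l : ι → ℂ}
    (hH : ∀ i ∈ s, HasFinitePart (H i) a (l i)) :
    HasFinitePart (fun x => ∑ i ∈ s, H i x) a (∑ i ∈ s, l i) := by
  classical
  induction s using Finset.induction_on with
  | empty =>
    rw [hasFinitePart_iff ha]
    exact ⟨fun ε _ _ => by simp, 0, 0, by simp, by simp [divergentPart]⟩
  | insert i s hi ih =>
    simp only [Finset.sum_insert hi]
    exact (hH i (Finset.mem_insert_self i s)).add ha
      (ih fun j hj => hH j (Finset.mem_insert_of_mem hj))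

/-- The finite part of a convergent integral is the integral. -/
theorem hasFinitePart_of_intervalIntegrable (ha : 0 < a) (hi : IntervalIntegrable h volume 0 a) :
    HasFinitePart h a (∫ x in (0 : ℝ)..a, h x) := by
  rw [hasFinitePart_iff ha]
  have hsub : ∀ ε, 0 < ε → ε < a → IntervalIntegrable h volume ε a := fun ε h0 h1 =>
    hi.mono_set (by
      rw [Set.uIcc_of_le h1.le, Set.uIcc_of_le ha.le]; exact Set.Icc_subset_Icc_left h0.le)
  refine ⟨hsub, 0, 0, by simp, ?_⟩
  have hc : ContinuousWithinAt (fun ε => ∫ x in a..ε, h x) (Set.uIcc 0 a) 0 :=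
    intervalIntegral.continuousOn_primitive_interval' hi Set.right_mem_uIcc 0 Set.left_mem_uIcc
  have hc' : Tendsto (fun ε => ∫ x in a..ε, h x) (𝓝[>] 0) (𝓝 (∫ x in a..0, h x)) :=
    hc.mono_left (nhdsWithin_le_iff.2 (by
      rw [Set.uIcc_of_le ha.le]
      exact mem_of_superset (Ioo_mem_nhdsGT ha) Set.Ioo_subset_Icc_self))
  rw [intervalIntegral.integral_symm]
  refine hc'.neg.congr fun ε => ?_
  simp [divergentPart, intervalIntegral.integral_symm a ε]

/-- Moving the regular endpoint changes the finite part by an ordinary integral. -/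
theorem HasFinitePart.change_endpoint (hb : 0 < b) (ha : 0 < a) (H : HasFinitePart h b L)
    (hi : ∀ u v : ℝ, 0 < u → u ≤ v → v ≤ max a b → IntervalIntegrable h volume u v) :
    HasFinitePart h a (L + ∫ x in b..a, h x) := by
  rw [hasFinitePart_iff hb] at H
  rw [hasFinitePart_iff ha]
  obtain ⟨-, c, d, p, t⟩ := H
  have hi' : ∀ u v : ℝ, 0 < u → 0 < v → u ≤ max a b → v ≤ max a b →
      IntervalIntegrable h volume u v := by
    intro u v hu hv hum hvm
    rcases le_total u v with huv | huv
    · exact hi u v hu huv hvm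
    · exact (hi v u hv huv hum).symm
  refine ⟨fun ε h0 h1 => hi ε a h0 h1.le (le_max_left _ _), c, d, p,
    (t.add_const _).congr' ?_⟩
  filter_upwards [Ioo_mem_nhdsGT ha] with ε hε
  have hεm : ε ≤ max a b := hε.2.le.trans (le_max_left _ _)
  rw [← intervalIntegral.integral_add_adjacent_intervals
    (hi' ε b hε.1 hb hεm (le_max_right _ _)) (hi' b a hb ha (le_max_right _ _) (le_max_left _ _))]
  ring

/-- The finite part of `∫₀ᵃ x^{-(j+1)} dx`. -/
def powFinitePart (a : ℝ) (j : ℕ) : ℂ :=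
  if j = 0 then (Real.log a : ℂ) else -(((a : ℂ) ^ j)⁻¹ / j)

theorem hasFinitePart_pow (ha : 0 < a) (j : ℕ) :
    HasFinitePart (fun x : ℝ => ((x : ℂ) ^ (j + 1))⁻¹) a (powFinitePart a j) := by
  have hi : ∀ ε : ℝ, 0 < ε → ε < a →
      IntervalIntegrable (fun x : ℝ => ((x : ℂ) ^ (j + 1))⁻¹) volume ε a := by
    intro ε h0 h1
    refine ContinuousOn.intervalIntegrable fun x hx => ?_
    rw [Set.uIcc_of_le h1.le] at hx
    have : (x : ℂ) ^ (j + 1) ≠ 0 := pow_ne_zero _ (by exact_mod_cast (h0.trans_le hx.1).ne')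
    exact ContinuousAt.continuousWithinAt (by fun_prop (disch := exact this))
  have hre : ∀ ε : ℝ, ∫ x in ε..a, ((x : ℂ) ^ (j + 1))⁻¹
      = ((∫ x in ε..a, (x ^ (j + 1))⁻¹ : ℝ) : ℂ) := by
    intro ε
    rw [← intervalIntegral.integral_ofReal]
    push_cast; rfl
  rw [hasFinitePart_iff ha]
  refine ⟨hi, ?_⟩
  rcases Nat.eq_zero_or_pos j with rfl | hj
  · refine ⟨0, -1, by simp, tendsto_const_nhds.congr' ?_⟩
    filter_upwards [Ioo_mem_nhdsGT ha] with ε hε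
    rw [hre]
    simp only [zero_add, pow_one, divergentPart, powFinitePart]
    rw [integral_inv_of_pos hε.1 ha, Real.log_div ha.ne' hε.1.ne']
    simp
  · have hj' : (j : ℝ) ≠ 0 := by exact_mod_cast hj.ne'
    refine ⟨Finsupp.single (j : ℝ) ((j : ℂ)⁻¹), 0, fun s hs => ?_, tendsto_const_nhds.congr' ?_⟩
    · rw [Finset.mem_singleton.1 (Finsupp.support_single_subset hs)]
      exact_mod_cast hj
    filter_upwards [Ioo_mem_nhdsGT ha] with ε hε
    have h0 : (0 : ℝ) ∉ Set.uIcc ε a := by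
      rw [Set.uIcc_of_le hε.2.le]; exact fun h => absurd h.1 (not_le.2 hε.1)
    have hz : ∀ x : ℝ, (x ^ (j + 1))⁻¹ = x ^ (-((j : ℤ) + 1)) := by
      intro x; rw [zpow_neg]; norm_cast
    rw [hre]
    simp only [hz]
    rw [integral_zpow (Or.inr ⟨by omega, h0⟩)]
    have e1 : -((j : ℤ) + 1) + 1 = -(j : ℤ) := by ring
    have e2 : ((-((j : ℤ) + 1) : ℤ) : ℝ) + 1 = -(j : ℝ) := by push_cast; ring
    rw [e1, e2, zpow_neg, zpow_neg, zpow_natCast, zpow_natCast]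
    simp only [divergentPart, powFinitePart, hj.ne', if_false]
    rw [Finsupp.sum_single_index (by simp), Real.rpow_neg hε.1.le, Real.rpow_natCast]
    push_cast
    have : (j : ℂ) ≠ 0 := by exact_mod_cast hj.ne'
    have h3 : (ε : ℂ) ≠ 0 := by exact_mod_cast hε.1.ne'
    have h4 : (a : ℂ) ≠ 0 := by exact_mod_cast ha.ne'
    field_simp
    ring

theorem norm_powFinitePart_le (ha : 0 < a) (j : ℕ) :
    ‖powFinitePart a j‖ ≤ (1 + |Real.log a|) / a ^ j := by
  unfold powFinitePart
  split_ifs with hj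
  · subst hj
    simp
  · have hj1 : (1 : ℝ) ≤ j := by exact_mod_cast Nat.one_le_iff_ne_zero.2 hj
    rw [norm_neg, norm_div, norm_inv, norm_pow, Complex.norm_real, Real.norm_of_nonneg ha.le,
      Complex.norm_natCast]
    calc (a ^ j)⁻¹ / j ≤ (a ^ j)⁻¹ := div_le_self (by positivity) hj1
      _ = 1 / a ^ j := (one_div _).symm
      _ ≤ _ := by gcongr; simp

/-! ### Principal values -/

theorem eventually_small {ω : ℝ} (hω : 0 < ω) (hωa : ω < a) :
    ∀ᶠ δ : ℝ in 𝓝[>] 0, 0 < δ ∧ δ < min ω (a - ω) :=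
  Ioo_mem_nhdsGT (lt_min hω (sub_pos.2 hωa))

theorem HasPV.add {ω : ℝ} (hω : 0 < ω) (hωa : ω < a) (H₁ : HasPV h₁ ω a L₁)
    (H₂ : HasPV h₂ ω a L₂) : HasPV (fun x => h₁ x + h₂ x) ω a (L₁ + L₂) := by
  refine ⟨fun δ h0 h1 => ⟨(H₁.1 δ h0 h1).1.add (H₂.1 δ h0 h1).1,
    (H₁.1 δ h0 h1).2.add (H₂.1 δ h0 h1).2⟩, (H₁.2.add H₂.2).congr' ?_⟩
  filter_upwards [eventually_small hω hωa] with δ hδ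
  rw [intervalIntegral.integral_add (H₁.1 δ hδ.1 hδ.2).1 (H₂.1 δ hδ.1 hδ.2).1,
    intervalIntegral.integral_add (H₁.1 δ hδ.1 hδ.2).2 (H₂.1 δ hδ.1 hδ.2).2]
  ring

theorem HasPV.const_mul {ω : ℝ} (b : ℂ) (H : HasPV h ω a L) :
    HasPV (fun x => b * h x) ω a (b * L) := by
  refine ⟨fun δ h0 h1 => ⟨(H.1 δ h0 h1).1.const_mul b, (H.1 δ h0 h1).2.const_mul b⟩,
    (H.2.const_mul b).congr fun δ => ?_⟩
  rw [intervalIntegral.integral_const_mul, intervalIntegral.integral_const_mul, mul_add]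

/-- The principal value does not see the value of the integrand at the singular point. -/
theorem HasPV.congr {ω : ℝ} (hω : 0 < ω) (hωa : ω < a) (H : HasPV h₁ ω a L)
    (he : ∀ x ∈ Set.Icc 0 a, x ≠ ω → h₁ x = h₂ x) : HasPV h₂ ω a L := by
  have l : ∀ δ, 0 < δ → δ < min ω (a - ω) → ∀ x ∈ Set.uIoc 0 (ω - δ), h₁ x = h₂ x := by
    intro δ h0 h1 x hx
    have := lt_min_iff.1 h1
    rw [Set.uIoc_of_le (by linarith)] at hx
    exact he x ⟨hx.1.le, by linarith [hx.2]⟩ (by linarith [hx.2])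
  have r : ∀ δ, 0 < δ → δ < min ω (a - ω) → ∀ x ∈ Set.uIoc (ω + δ) a, h₁ x = h₂ x := by
    intro δ h0 h1 x hx
    have := lt_min_iff.1 h1
    rw [Set.uIoc_of_le (by linarith)] at hx
    exact he x ⟨by linarith [hx.1], hx.2⟩ (by linarith [hx.1])
  refine ⟨fun δ h0 h1 => ⟨(H.1 δ h0 h1).1.congr (l δ h0 h1), (H.1 δ h0 h1).2.congr (r δ h0 h1)⟩,
    H.2.congr' ?_⟩
  filter_upwards [eventually_small hω hωa] with δ hδ
  rw [intervalIntegral.integral_congr_ae (Eventually.of_forall (l δ hδ.1 hδ.2)),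
    intervalIntegral.integral_congr_ae (Eventually.of_forall (r δ hδ.1 hδ.2))]

/-- The principal value of a convergent integral is the integral. -/
theorem hasPV_of_intervalIntegrable {ω : ℝ} (hω : 0 < ω) (hωa : ω < a)
    (hi : IntervalIntegrable h volume 0 a) : HasPV h ω a (∫ x in (0 : ℝ)..a, h x) := by
  have ha : 0 < a := hω.trans hωa
  have hsub : ∀ u v : ℝ, 0 ≤ u → u ≤ v → v ≤ a → IntervalIntegrable h volume u v :=
    fun u v h0 h1 h2 => hi.mono_set (by
      rw [Set.uIcc_of_le h1, Set.uIcc_of_le ha.le]; exact Set.Icc_subset_Icc h0 h2)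
  refine ⟨fun δ h0 h1 => ?_, ?_⟩
  · have := lt_min_iff.1 h1
    exact ⟨hsub _ _ le_rfl (by linarith) (by linarith), hsub _ _ (by linarith) (by linarith) le_rfl⟩
  have hc : ContinuousAt (fun t => ∫ x in (0 : ℝ)..t, h x) ω :=
    (intervalIntegral.continuousOn_primitive_interval' hi Set.left_mem_uIcc).continuousAt
      (by rw [Set.uIcc_of_le ha.le]; exact Icc_mem_nhds hω hωa)
  have hl : Tendsto (fun δ : ℝ => ω - δ) (𝓝[>] 0) (𝓝 ω) := by
    have : Continuous fun δ : ℝ => ω - δ := by fun_prop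
    simpa using (this.tendsto 0).mono_left nhdsWithin_le_nhds
  have hr : Tendsto (fun δ : ℝ => ω + δ) (𝓝[>] 0) (𝓝 ω) := by
    have : Continuous fun δ : ℝ => ω + δ := by fun_prop
    simpa using (this.tendsto 0).mono_left nhdsWithin_le_nhds
  have ht := ((hc.tendsto.comp hl).sub (hc.tendsto.comp hr)).add_const (∫ x in (0 : ℝ)..a, h x)
  rw [sub_self, zero_add] at ht
  refine ht.congr' ?_
  filter_upwards [eventually_small hω hωa] with δ hδ
  have := lt_min_iff.1 hδ.2
  simp only [Function.comp]
  rw [← intervalIntegral.integral_add_adjacent_intervals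
    (hsub 0 (ω + δ) le_rfl (by linarith) (by linarith))
    (hsub (ω + δ) a (by linarith) (by linarith) le_rfl)]
  ring

theorem hasPV_inv {ω : ℝ} (hω : 0 < ω) (hωa : ω < a) :
    HasPV (fun x => ((ω : ℂ) - (x : ℂ))⁻¹) ω a
      ((Real.log ω : ℂ) - (Real.log (a - ω) : ℂ)) := by
  have hint : ∀ u v : ℝ, ω ∉ Set.uIcc u v →
      IntervalIntegrable (fun x : ℝ => ((ω : ℂ) - (x : ℂ))⁻¹) volume u v := by
    intro u v huv
    refine ContinuousOn.intervalIntegrable fun x hx => ?_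
    have : (ω : ℂ) - (x : ℂ) ≠ 0 := by
      rw [sub_ne_zero]; exact_mod_cast fun h : ω = x => huv (by rwa [h])
    exact ContinuousAt.continuousWithinAt (by fun_prop (disch := exact this))
  have l : ∀ δ, 0 < δ → δ < min ω (a - ω) → ω ∉ Set.uIcc 0 (ω - δ) := by
    intro δ h0 h1 h
    have := lt_min_iff.1 h1
    rw [Set.uIcc_of_le (by linarith)] at h
    linarith [h.2]
  have r : ∀ δ, 0 < δ → δ < min ω (a - ω) → ω ∉ Set.uIcc (ω + δ) a := by
    intro δ h0 h1 h
    have := lt_min_iff.1 h1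
    rw [Set.uIcc_of_le (by linarith)] at h
    linarith [h.1]
  refine ⟨fun δ h0 h1 => ⟨hint _ _ (l δ h0 h1), hint _ _ (r δ h0 h1)⟩,
    tendsto_const_nhds.congr' ?_⟩
  filter_upwards [eventually_small hω hωa] with δ hδ
  have h1 := lt_min_iff.1 hδ.2
  have hre : ∀ u v : ℝ, ∫ x in u..v, ((ω : ℂ) - (x : ℂ))⁻¹
      = ((∫ x in u..v, (ω - x)⁻¹ : ℝ) : ℂ) := by
    intro u v
    rw [← intervalIntegral.integral_ofReal]
    push_cast; rfl
  rw [hre, hre, intervalIntegral.integral_comp_sub_left (fun x => x⁻¹),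
    intervalIntegral.integral_comp_sub_left (fun x => x⁻¹), sub_sub_cancel, sub_zero,
    integral_inv_of_pos hδ.1 hω, integral_inv_of_neg (by linarith) (by linarith),
    Real.log_div hω.ne' hδ.1.ne',
    Real.log_div (by linarith) (by linarith), show ω - (ω + δ) = -δ by ring,
    show ω - a = -(a - ω) by ring, Real.log_neg_eq_log, Real.log_neg_eq_log]
  push_cast
  ring

/-- Moving the regular endpoint changes the principal value by an ordinary integral. -/
theorem HasPV.eq_add_integral {ω : ℝ} (hω : 0 < ω) (hωa : ω < a)
    (H₁ : HasPV h ω a L₁) (H₂ : HasPV h ω b L₂) (hi : IntervalIntegrable h volume a b) :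
    L₂ = L₁ + ∫ x in a..b, h x := by
  refine tendsto_nhds_unique H₂.2 ((H₁.2.add_const _).congr' ?_)
  filter_upwards [eventually_small hω hωa] with δ hδ
  rw [← intervalIntegral.integral_add_adjacent_intervals (H₁.1 δ hδ.1 hδ.2).2 hi]
  ring

/-! ### Geometric bounds for the finite parts -/

/-- If `g` has an absolutely convergent power series on `[0, σ]`, the finite parts of
`∫₀^σ g(x) x^{-(k+1)} dx` are `O(σ^{-k})`: the first `k + 1` terms of the series contribute
explicit powers of `σ`, and the remainder divided by `x^{k+1}` is again a power series,
bounded by a multiple of `σ^{-(k+1)}`. -/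
theorem exists_finitePart_of_series {g : ℝ → ℂ} {c : ℕ → ℂ} {σ : ℝ} (hσ : 0 < σ)
    (hc : Summable fun n => ‖c n‖ * σ ^ n)
    (hg : ∀ x ∈ Set.Icc 0 σ, HasSum (fun n => c n * (x : ℂ) ^ n) (g x)) :
    ∃ C : ℝ, ∀ k : ℕ, ∃ L : ℂ,
      HasFinitePart (fun x => g x / (x : ℂ) ^ (k + 1)) σ L ∧ ‖L‖ ≤ C / σ ^ k := by
  set M := ∑' n, ‖c n‖ * σ ^ n with hM
  set K := 1 + |Real.log σ| with hK
  refine ⟨K * M + M, fun k => ?_⟩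
  have hshift : Summable fun n => ‖c (n + (k + 1))‖ * σ ^ n := by
    refine ((summable_nat_add_iff (k + 1)).2 hc |>.div_const (σ ^ (k + 1))).congr fun n => ?_
    rw [pow_add σ n (k + 1)]
    field_simp
  have hshift_le : ∑' n, ‖c (n + (k + 1))‖ * σ ^ n ≤ M / σ ^ (k + 1) := by
    have e : ∀ n, ‖c (n + (k + 1))‖ * σ ^ n
        = ‖c (n + (k + 1))‖ * σ ^ (n + (k + 1)) / σ ^ (k + 1) := fun n => by
      rw [pow_add σ n (k + 1)]
      field_simp
    simp only [e]
    rw [tsum_div_const]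
    gcongr
    rw [hM, ← hc.sum_add_tsum_nat_add (k + 1)]
    exact le_add_of_nonneg_left (Finset.sum_nonneg fun _ _ => by positivity)
  set R : ℝ → ℂ := fun x => ∑' n, c (n + (k + 1)) * (x : ℂ) ^ n with hR
  have hterm : ∀ n, ∀ x ∈ Set.Icc 0 σ,
      ‖c (n + (k + 1)) * (x : ℂ) ^ n‖ ≤ ‖c (n + (k + 1))‖ * σ ^ n := by
    intro n x hx
    rw [norm_mul, norm_pow, Complex.norm_real, Real.norm_of_nonneg hx.1]
    gcongr
    · exact hx.1
    · exact hx.2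
  have hRc : ContinuousOn R (Set.Icc 0 σ) :=
    continuousOn_tsum (fun n => by fun_prop) hshift hterm
  have hRi : IntervalIntegrable R volume 0 σ :=
    ContinuousOn.intervalIntegrable (by rwa [Set.uIcc_of_le hσ.le])
  have hRb : ‖∫ x in (0 : ℝ)..σ, R x‖ ≤ M / σ ^ k := by
    have := intervalIntegral.norm_integral_le_of_norm_le_const (f := R) (a := 0) (b := σ)
      (C := M / σ ^ (k + 1)) (fun x hx => by
        rw [Set.uIoc_of_le hσ.le] at hx
        exact (tsum_of_norm_bounded hshift.hasSum
          (fun n => hterm n x ⟨hx.1.le, hx.2⟩)).trans hshift_le)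
    refine this.trans (le_of_eq ?_)
    rw [sub_zero, abs_of_pos hσ, pow_succ]
    field_simp
  refine ⟨(∑ n ∈ Finset.range (k + 1), c n * powFinitePart σ (k - n)) + ∫ x in (0 : ℝ)..σ, R x,
    ?_, ?_⟩
  · refine ((HasFinitePart.sum hσ (Finset.range (k + 1)) fun n _ =>
      (hasFinitePart_pow hσ (k - n)).const_mul hσ (c n)).add hσ
      (hasFinitePart_of_intervalIntegrable hσ hRi)).congr hσ fun x hx => ?_
    have hx0 : (x : ℂ) ≠ 0 := by exact_mod_cast hx.1.ne'
    have hs := hg x ⟨hx.1.le, hx.2⟩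
    rw [← hs.tsum_eq, ← hs.summable.sum_add_tsum_nat_add (k + 1), add_div, Finset.sum_div]
    congr 1
    · refine Finset.sum_congr rfl fun n hn => ?_
      have hn' : n ≤ k := Nat.lt_succ_iff.1 (Finset.mem_range.1 hn)
      have e : (x : ℂ) ^ (k + 1) = (x : ℂ) ^ n * (x : ℂ) ^ (k - n + 1) := by
        rw [← pow_add]; congr 1; omega
      rw [e, mul_comm (c n) ((x : ℂ) ^ n), mul_div_mul_left _ _ (pow_ne_zero n hx0), div_eq_mul_inv]
    · rw [← tsum_div_const]
      refine tsum_congr fun n => ?_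
      rw [pow_add]
      field_simp
  · refine (norm_add_le _ _).trans ?_
    rw [add_div]
    refine add_le_add ?_ hRb
    calc ‖∑ n ∈ Finset.range (k + 1), c n * powFinitePart σ (k - n)‖
        ≤ ∑ n ∈ Finset.range (k + 1), K * (‖c n‖ * σ ^ n) / σ ^ k := by
          refine norm_sum_le_of_le _ fun n hn => ?_
          have hn' : n ≤ k := Nat.lt_succ_iff.1 (Finset.mem_range.1 hn)
          rw [norm_mul]
          refine (mul_le_mul_of_nonneg_left (norm_powFinitePart_le hσ (k - n))
            (norm_nonneg _)).trans (le_of_eq ?_)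
          have e : σ ^ k = σ ^ n * σ ^ (k - n) := by rw [← pow_add]; congr 1; omega
          rw [e, ← hK]
          field_simp
      _ = K * (∑ n ∈ Finset.range (k + 1), ‖c n‖ * σ ^ n) / σ ^ k := by
          rw [← Finset.sum_div, ← Finset.mul_sum]
      _ ≤ K * M / σ ^ k := by
          have hK0 : 0 ≤ K := by positivity
          gcongr
          exact hc.sum_le_tsum _ fun _ _ => by positivity

/-- The bound of `exists_finitePart_of_series` persists on a longer interval `[0, a]` on which `g`
is continuous, since `x^{-(k+1)} ≤ σ^{-(k+1)}` on `[σ, a]`. -/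
theorem exists_finitePart_of_series_of_continuousOn {g : ℝ → ℂ} {c : ℕ → ℂ} {σ a : ℝ}
    (hσ : 0 < σ) (hσa : σ ≤ a) (hc : Summable fun n => ‖c n‖ * σ ^ n)
    (hg : ∀ x ∈ Set.Icc 0 σ, HasSum (fun n => c n * (x : ℂ) ^ n) (g x))
    (hcont : ContinuousOn g (Set.Icc 0 a)) :
    ∃ C : ℝ, ∀ k : ℕ, ∃ L : ℂ,
      HasFinitePart (fun x => g x / (x : ℂ) ^ (k + 1)) a L ∧ ‖L‖ ≤ C / σ ^ k := by
  obtain ⟨C, hC⟩ := exists_finitePart_of_series hσ hc hg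
  obtain ⟨B, hB⟩ := isCompact_Icc.exists_bound_of_continuousOn hcont
  refine ⟨C + B * (a - σ) / σ, fun k => ?_⟩
  obtain ⟨L, hL, hLn⟩ := hC k
  refine ⟨_, hL.change_endpoint hσ (hσ.trans_le hσa) fun u v hu huv hv => ?_, ?_⟩
  · refine ContinuousOn.intervalIntegrable ?_
    rw [Set.uIcc_of_le huv]
    rw [max_eq_left hσa] at hv
    refine (hcont.mono (Set.Icc_subset_Icc hu.le hv)).div (by fun_prop) fun x hx => ?_
    exact pow_ne_zero _ (by exact_mod_cast (hu.trans_le hx.1).ne')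
  · refine (norm_add_le _ _).trans ?_
    rw [add_div]
    refine add_le_add hLn ?_
    have := intervalIntegral.norm_integral_le_of_norm_le_const
      (f := fun x : ℝ => g x / (x : ℂ) ^ (k + 1)) (a := σ) (b := a)
      (C := B / σ ^ (k + 1)) (fun x hx => by
        rw [Set.uIoc_of_le hσa] at hx
        have hx0 : 0 < x := hσ.trans hx.1
        have hb := hB x ⟨hx0.le, hx.2⟩
        have hB0 : 0 ≤ B := (norm_nonneg _).trans hb
        rw [norm_div, norm_pow, Complex.norm_real, Real.norm_of_nonneg hx0.le]
        gcongr
        exact hx.1.le)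
    refine this.trans (le_of_eq ?_)
    rw [abs_of_nonneg (sub_nonneg.2 hσa), pow_succ]
    field_simp

/-! ### Analytic extensions -/

/-- `f`, given on `I`, has an extension that is analytic on `I` and in the disc `|z| < ρ`. -/
def AnalyticOnDisc (f : ℝ → ℂ) (I : Set ℝ) (ρ : ℝ) : Prop :=
  ∃ F : ℂ → ℂ, AnalyticOnNhd ℂ F (Metric.ball 0 ρ ∪ (fun x : ℝ => (x : ℂ)) '' I) ∧ Extends F f I

theorem AnalyticOnDisc.mono {f : ℝ → ℂ} {I J : Set ℝ} {ρ : ℝ} (H : AnalyticOnDisc f J ρ)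
    (hIJ : I ⊆ J) : AnalyticOnDisc f I ρ := by
  obtain ⟨F, hF, he⟩ := H
  exact ⟨F, hF.mono (Set.union_subset_union_right _ (Set.image_mono hIJ)),
    fun x hx => he x (hIJ hx)⟩

theorem AnalyticOnDisc.continuousOn {f : ℝ → ℂ} {I : Set ℝ} {ρ : ℝ} (H : AnalyticOnDisc f I ρ) :
    ContinuousOn f I := by
  obtain ⟨F, hF, he⟩ := H
  refine ContinuousOn.congr (f := fun x : ℝ => F x) ?_ fun x hx => (he x hx).symm
  exact (hF.continuousOn.mono Set.subset_union_right).comp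
    Complex.continuous_ofReal.continuousOn (Set.mapsTo_image _ _)

theorem exists_analyticOnDisc_of_lt_singularityDistance {f : ℝ → ℂ} {I : Set ℝ} {ω : ℝ}
    (h : ENNReal.ofReal ω < singularityDistance f I) : ∃ ρ, ω < ρ ∧ AnalyticOnDisc f I ρ := by
  obtain ⟨r, ⟨F, hF, he⟩, hr⟩ := lt_sSup_iff.1 h
  obtain ⟨ρ, hρ1, hρ2⟩ := ENNReal.lt_iff_exists_nnreal_btwn.1 hr
  refine ⟨ρ, ?_, F, hF.mono (Set.union_subset_union_left _ fun z hz => ?_), he⟩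
  · rw [← ENNReal.ofReal_coe_nnreal] at hρ1
    exact (ENNReal.ofReal_lt_ofReal_iff').1 hρ1 |>.1
  · have : ‖z‖ < ρ := by simpa using hz
    refine lt_of_le_of_lt ?_ hρ2
    rw [← ENNReal.ofReal_coe_nnreal]
    exact ENNReal.ofReal_le_ofReal this.le

theorem ExtendsToEntire.analyticOnDisc {f : ℝ → ℂ} {I : Set ℝ} (h : ExtendsToEntire f I) (ρ : ℝ) :
    AnalyticOnDisc f I ρ := by
  obtain ⟨F, hF, he⟩ := h
  exact ⟨F, hF.mono (Set.subset_univ _), he⟩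

/-- Dividing out a zero at the origin does not shrink the disc of analyticity. -/
theorem AnalyticOnDisc.of_mul_pow {f g : ℝ → ℂ} {I : Set ℝ} {ρ a : ℝ} {m : ℕ}
    (H : AnalyticOnDisc f I ρ) (hg : ComplexAnalytic g I) (ha : 0 < a) (haI : Set.Icc 0 a ⊆ I)
    (hfg : ∀ x ∈ I, f x = (x : ℂ) ^ m * g x) : AnalyticOnDisc g I ρ := by
  obtain ⟨F, hF, hFe⟩ := H
  obtain ⟨G, hG, hGe⟩ := hg
  have h0I : (0 : ℝ) ∈ I := haI ⟨le_rfl, ha.le⟩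
  have hF0 : AnalyticAt ℂ F 0 := hF 0 (Or.inr ⟨0, h0I, by simp⟩)
  have hG0 : AnalyticAt ℂ G 0 := hG 0 ⟨0, h0I, by simp⟩
  -- The extensions satisfy `F = z^m G` on `[0, a]`, hence near `0` by the identity theorem.
  have hloc : ∀ᶠ z in 𝓝 (0 : ℂ), F z = z ^ m * G z := by
    have hA : AnalyticAt ℂ (fun z : ℂ => z ^ m * G z) 0 := by fun_prop
    refine (hF0.frequently_eq_iff_eventually_eq hA).1 ?_
    have ht : Tendsto (fun x : ℝ => (x : ℂ)) (𝓝[>] 0) (𝓝[≠] 0) := by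
      refine tendsto_nhdsWithin_iff.2 ⟨?_, ?_⟩
      · simpa using (Complex.continuous_ofReal.tendsto 0).mono_left nhdsWithin_le_nhds
      · filter_upwards [self_mem_nhdsWithin] with x hx
        have : x ≠ 0 := (Set.mem_Ioi.1 hx).ne'
        simpa using this
    refine ht.frequently (Eventually.frequently ?_)
    filter_upwards [Ioo_mem_nhdsGT ha] with x hx
    have hxI := haI ⟨hx.1.le, hx.2.le⟩
    rw [hFe x hxI, hGe x hxI, hfg x hxI]
  refine ⟨fun z => if z = 0 then G 0 else F z / z ^ m, fun z hz => ?_, fun x hx => ?_⟩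
  · by_cases hz0 : z = 0
    · subst hz0
      refine hG0.congr ?_
      filter_upwards [hloc] with w hw
      split_ifs with hw0
      · rw [hw0]
      · rw [hw, mul_div_cancel_left₀ _ (pow_ne_zero m hw0)]
    · have hd : AnalyticAt ℂ (fun z => F z / z ^ m) z :=
        (hF z hz).div (by fun_prop) (pow_ne_zero m hz0)
      refine hd.congr ?_
      filter_upwards [isOpen_ne.mem_nhds hz0] with w hw
      rw [if_neg hw]
  · by_cases hx0 : x = 0
    · subst hx0
      simpa using hGe 0 h0I
    · have hx0' : (x : ℂ) ≠ 0 := by exact_mod_cast hx0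
      simp only [hx0', if_false]
      rw [hFe x hx, hfg x hx, mul_div_cancel_left₀ _ (pow_ne_zero m hx0')]

theorem analyticOnNhd_dslope {F : ℂ → ℂ} {s : Set ℂ} (hF : AnalyticOnNhd ℂ F s) {w : ℂ} :
    AnalyticOnNhd ℂ (dslope F w) s := by
  intro z hz
  by_cases hzw : z = w
  · subst hzw
    obtain ⟨p, hp⟩ := hF z hz
    exact ⟨_, hp.has_fpower_series_dslope_fslope⟩
  · refine AnalyticAt.congr ?_ (dslope_eventuallyEq_slope_of_ne F hzw).symm
    have : AnalyticAt ℂ (fun z => (z - w)⁻¹ • (F z - F w)) z := by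
      have hzw' : z - w ≠ 0 := sub_ne_zero.2 hzw
      have := hF z hz
      fun_prop (disch := exact hzw')
    exact this

/-- The difference quotient of `f` at a point of `I` inherits the domain of analyticity. -/
theorem AnalyticOnDisc.exists_slope {f : ℝ → ℂ} {I : Set ℝ} {ρ ω : ℝ} (H : AnalyticOnDisc f I ρ)
    (hω : ω ∈ I) : ∃ G : ℝ → ℂ, AnalyticOnDisc G I ρ ∧
      ∀ x ∈ I, f x = f ω + ((x : ℂ) - (ω : ℂ)) * G x := by
  obtain ⟨F, hF, he⟩ := H
  refine ⟨fun x => dslope F ω x, ⟨dslope F ω, analyticOnNhd_dslope hF, fun x _ => rfl⟩,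
    fun x hx => ?_⟩
  rw [← he x hx, ← he ω hω, ← smul_eq_mul, sub_smul_dslope]
  ring

theorem AnalyticOnDisc.exists_series {f : ℝ → ℂ} {I : Set ℝ} {ρ σ : ℝ} (H : AnalyticOnDisc f I ρ)
    (hσ : 0 < σ) (hσρ : σ < ρ) (hI : Set.Icc 0 σ ⊆ I) :
    ∃ c : ℕ → ℂ, (Summable fun n => ‖c n‖ * σ ^ n) ∧
      ∀ x ∈ Set.Icc 0 σ, HasSum (fun n => c n * (x : ℂ) ^ n) (f x) := by
  obtain ⟨F, hF, he⟩ := H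
  obtain ⟨τ, hτ1, hτ2⟩ := exists_between hσρ
  have hτ : 0 < τ := hσ.trans hτ1
  lift τ to NNReal using hτ.le
  lift σ to NNReal using hσ.le
  have hd : DifferentiableOn ℂ F (Metric.closedBall 0 τ) :=
    (hF.differentiableOn).mono fun z hz => Or.inl (Metric.closedBall_subset_ball hτ2 hz)
  have hp := hd.hasFPowerSeriesOnBall (by exact_mod_cast hτ)
  set p := cauchyPowerSeries F 0 τ
  have hστ : (σ : ENNReal) < τ := by exact_mod_cast hτ1
  refine ⟨p.coeff, ?_, fun x hx => ?_⟩
  · refine (p.summable_norm_mul_pow (hστ.trans_le hp.r_le)).congr fun n => ?_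
    rw [FormalMultilinearSeries.norm_apply_eq_norm_coef]
  · have hs := hp.hasSum (y := (x : ℂ)) (by
      rw [Metric.eball_coe]
      simp only [Metric.mem_ball, dist_zero_right, Complex.norm_real, Real.norm_of_nonneg hx.1]
      exact hx.2.trans_lt hτ1)
    rw [zero_add, he x (hI hx)] at hs
    refine hs.congr_fun fun n => ?_
    rw [FormalMultilinearSeries.apply_eq_pow_smul_coeff, smul_eq_mul, mul_comm]

/-! ### The expansion on a finite interval -/

theorem hasSum_telescoping {ψ : ℕ → ℂ} {ω σ C : ℝ} (hω : 0 < ω) (hωσ : ω < σ)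
    (hψ : ∀ k, ‖ψ (k + 1)‖ ≤ C / σ ^ k) :
    HasSum (fun k : ℕ => (ω : ℂ) ^ k * (ψ k - ω * ψ (k + 1))) (ψ 0) := by
  have hσ : 0 < σ := hω.trans hωσ
  have hgeo : Summable fun k : ℕ => ω * C * (ω / σ) ^ k :=
    (summable_geometric_of_lt_one (by positivity) ((div_lt_one hσ).2 hωσ)).mul_left _
  -- Each of the two shifted series converges absolutely; their difference is the term `k = 0`.
  have h1 : Summable fun k : ℕ => (ω : ℂ) ^ (k + 1) * ψ (k + 1) := by
    refine hgeo.of_norm_bounded fun k => ?_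
    rw [norm_mul, norm_pow, Complex.norm_real, Real.norm_of_nonneg hω.le]
    refine (mul_le_mul_of_nonneg_left (hψ k) (by positivity)).trans (le_of_eq ?_)
    rw [div_pow, pow_succ]
    field_simp
  have h2 : Summable fun k : ℕ => (ω : ℂ) ^ k * ψ k := (summable_nat_add_iff 1).1 h1
  have h3 := h2.hasSum.sub ((hasSum_nat_add_iff' 1).2 h2.hasSum)
  simp only [Finset.range_one, Finset.sum_singleton, pow_zero, one_mul, sub_sub_cancel] at h3
  refine h3.congr_fun fun k => ?_
  rw [pow_succ]
  ring

theorem hasSum_powFinitePart {ω a : ℝ} (hω : 0 < ω) (hωa : ω < a) :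
    HasSum (fun k : ℕ => (ω : ℂ) ^ k * powFinitePart a k) (Real.log (a - ω) : ℂ) := by
  have ha : 0 < a := hω.trans hωa
  have hlt : |ω / a| < 1 := by
    rw [abs_of_pos (by positivity)]; exact (div_lt_one ha).2 hωa
  have h1 := (Complex.hasSum_ofReal.2 (Real.hasSum_pow_div_log_of_abs_lt_one hlt)).neg
  have hlog : Real.log (a - ω) = Real.log a + Real.log (1 - ω / a) := by
    rw [← Real.log_mul ha.ne' (sub_pos.2 ((div_lt_one ha).2 hωa)).ne']
    congr 1
    field_simp
  rw [← hasSum_nat_add_iff' 1, hlog]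
  simp only [Finset.range_one, Finset.sum_singleton, pow_zero, one_mul]
  convert h1 using 1
  · funext k
    have : (a : ℂ) ≠ 0 := by exact_mod_cast ha.ne'
    simp only [powFinitePart, Nat.succ_ne_zero, if_false]
    push_cast
    rw [div_pow]
    field_simp
  · simp [powFinitePart]

/-- The expansion for a function with extension analytic in a disc of radius larger than `ω`.
Write `f(x) = f(ω) + (x - ω) G(x)`. The finite parts `ψ k` of `∫₀ᵃ G(x) x^{-k} dx` enter the
`k`-th term of the series as `ω^k (ψ k - ω ψ (k + 1))`, so the series collapses to `∫₀ᵃ G`. -/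
theorem AnalyticOnDisc.exists_expansion {f : ℝ → ℂ} {a ρ ω : ℝ}
    (H : AnalyticOnDisc f (Set.Icc 0 a) ρ) (hω : 0 < ω) (hωa : ω < a) (hωρ : ω < ρ) :
    ∃ (p : ℕ → ℂ) (S : ℂ),
      (∀ k : ℕ, HasFinitePart (fun x => f x / (x : ℂ) ^ (k + 1)) a (p k)) ∧
      HasSum (fun k : ℕ => (ω : ℂ) ^ k * p k) S ∧
      HasPV (fun x => f x / ((ω : ℂ) - (x : ℂ))) ω a (-S + f ω * (Real.log ω : ℂ)) := by
  have ha : 0 < a := hω.trans hωa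
  obtain ⟨σ, hσ1, hσ2⟩ := exists_between (lt_min hωa hωρ)
  obtain ⟨hσa, hσρ⟩ := lt_min_iff.1 hσ2
  have hσ : 0 < σ := hω.trans hσ1
  obtain ⟨G, hG, hfG⟩ := H.exists_slope (ω := ω) ⟨hω.le, hωa.le⟩
  obtain ⟨c, hc, hcs⟩ := hG.exists_series hσ hσρ (Set.Icc_subset_Icc_right hσa.le)
  have hGi : IntervalIntegrable G volume 0 a :=
    ContinuousOn.intervalIntegrable (by rw [Set.uIcc_of_le ha.le]; exact hG.continuousOn)
  obtain ⟨C, hC⟩ :=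
    exists_finitePart_of_series_of_continuousOn hσ hσa.le hc hcs hG.continuousOn
  choose φ hφ hφn using hC
  set ψ : ℕ → ℂ := fun k => Nat.casesOn k (∫ x in (0 : ℝ)..a, G x) φ with hψdef
  have hψ : ∀ k, HasFinitePart (fun x => G x / (x : ℂ) ^ k) a (ψ k) := by
    rintro (_ | k)
    · simpa [hψdef] using hasFinitePart_of_intervalIntegrable ha hGi
    · exact hφ k
  refine ⟨fun k => f ω * powFinitePart a k + (ψ k - ω * ψ (k + 1)),
    f ω * (Real.log (a - ω) : ℂ) + ψ 0, fun k => ?_, ?_, ?_⟩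
  · have h1 := ((hasFinitePart_pow ha k).const_mul ha (f ω)).add ha
      ((hψ k).add ha ((hψ (k + 1)).const_mul ha (-(ω : ℂ))))
    have h2 : f ω * powFinitePart a k + (ψ k - ω * ψ (k + 1))
        = f ω * powFinitePart a k + (ψ k + -(ω : ℂ) * ψ (k + 1)) := by ring
    beta_reduce
    rw [h2]
    refine h1.congr ha fun x hx => ?_
    have hx0 : (x : ℂ) ≠ 0 := by exact_mod_cast hx.1.ne'
    rw [hfG x ⟨hx.1.le, hx.2⟩, pow_succ]
    field_simp
    ring
  · refine (((hasSum_powFinitePart hω hωa).mul_left (f ω)).add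
      (hasSum_telescoping hω hσ1 hφn)).congr_fun fun k => ?_
    simp only [hψdef]
    ring
  · have h1 := ((hasPV_inv hω hωa).const_mul (f ω)).add hω hωa
      ((hasPV_of_intervalIntegrable hω hωa hGi).const_mul (-1))
    have h2 : -(f ω * (Real.log (a - ω) : ℂ) + ψ 0) + f ω * (Real.log ω : ℂ)
        = f ω * ((Real.log ω : ℂ) - (Real.log (a - ω) : ℂ))
          + -1 * ∫ x in (0 : ℝ)..a, G x := by
      rw [show ψ 0 = ∫ x in (0 : ℝ)..a, G x from rfl]
      ring
    rw [h2]
    refine h1.congr hω hωa fun x hx hxω => ?_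
    have : (ω : ℂ) - (x : ℂ) ≠ 0 := sub_ne_zero.2 (by exact_mod_cast hxω.symm)
    rw [hfG x hx]
    field_simp
    ring

theorem intervalIntegrable_pow_mul {g : ℝ → ℂ} {a : ℝ} (ha : 0 ≤ a)
    (hg : ContinuousOn g (Set.Icc 0 a)) (j : ℕ) :
    IntervalIntegrable (fun x : ℝ => (x : ℂ) ^ j * g x) volume 0 a := by
  refine ContinuousOn.intervalIntegrable ?_
  rw [Set.uIcc_of_le ha]
  exact ContinuousOn.mul (by fun_prop) hg

/-- Since `xᵐ = ωᵐ - (ω - x) ∑_{k<m} ωᵏ x^{m-1-k}`, a factor `xᵐ` is moved out of the principal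
value at the cost of ordinary integrals. -/
theorem HasPV.pow_mul {f g : ℝ → ℂ} {a ω : ℝ} {L : ℂ} (hω : 0 < ω) (hωa : ω < a)
    (hg : ContinuousOn g (Set.Icc 0 a)) (m : ℕ)
    (hfg : ∀ x ∈ Set.Icc 0 a, f x = (x : ℂ) ^ m * g x)
    (H : HasPV (fun x => g x / ((ω : ℂ) - (x : ℂ))) ω a L) :
    HasPV (fun x => f x / ((ω : ℂ) - (x : ℂ))) ω a
      ((ω : ℂ) ^ m * L - ∑ k ∈ Finset.range m,
        (ω : ℂ) ^ k * ∫ x in (0 : ℝ)..a, (x : ℂ) ^ (m - k - 1) * g x) := by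
  have hi : ∀ k ∈ Finset.range m, IntervalIntegrable
      (fun x : ℝ => (ω : ℂ) ^ k * ((x : ℂ) ^ (m - k - 1) * g x)) volume 0 a := fun k _ =>
    (intervalIntegrable_pow_mul (hω.trans hωa).le hg _).const_mul _
  have h1 := (H.const_mul ((ω : ℂ) ^ m)).add hω hωa
    ((hasPV_of_intervalIntegrable hω hωa
      (IntervalIntegrable.sum (Finset.range m) hi)).const_mul (-1))
  rw [neg_one_mul, ← sub_eq_add_neg] at h1
  simp only [Finset.sum_apply] at h1
  rw [intervalIntegral.integral_finsetSum hi] at h1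
  simp only [intervalIntegral.integral_const_mul] at h1
  refine h1.congr hω hωa fun x hx hxω => ?_
  have hne : (ω : ℂ) - (x : ℂ) ≠ 0 := sub_ne_zero.2 (by exact_mod_cast hxω.symm)
  have hgeom := (Commute.all (ω : ℂ) (x : ℂ)).geom_sum₂_mul m
  rw [hfg x hx]
  have hsum : ∑ k ∈ Finset.range m, (ω : ℂ) ^ k * ((x : ℂ) ^ (m - k - 1) * g x)
      = (∑ k ∈ Finset.range m, (ω : ℂ) ^ k * (x : ℂ) ^ (m - 1 - k)) * g x := by
    rw [Finset.sum_mul]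
    refine Finset.sum_congr rfl fun k _ => ?_
    rw [Nat.sub_right_comm, mul_assoc]
  rw [hsum]
  field_simp
  linear_combination (-g x) * hgeom

/-! ### Tails at infinity -/

/-- A convergent integral stays convergent after division by `x^k`, with value `O(b^{-k})`:
integrate by parts against the bounded primitive `∫_b^x h`. -/
theorem exists_tendsto_integral_div_pow {h : ℝ → ℂ} {b : ℝ} {τ : ℂ} (hb : 0 < b)
    (hc : ContinuousOn h (Set.Ici b))
    (ht : Tendsto (fun A => ∫ x in b..A, h x) atTop (𝓝 τ)) :
    ∃ M : ℝ, ∀ k : ℕ, ∃ t : ℂ,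
      Tendsto (fun A => ∫ x in b..A, h x / (x : ℂ) ^ k) atTop (𝓝 t) ∧ ‖t‖ ≤ M / b ^ k := by
  set H : ℝ → ℂ := fun A => ∫ x in b..A, h x with hH
  have hint : ∀ A, b ≤ A → IntervalIntegrable h volume b A := fun A hA =>
    ContinuousOn.intervalIntegrable (by
      rw [Set.uIcc_of_le hA]; exact hc.mono Set.Icc_subset_Ici_self)
  have hHc : ∀ A, b ≤ A → ContinuousOn H (Set.uIcc b A) := fun A hA =>
    intervalIntegral.continuousOn_primitive_interval' (hint A hA) Set.left_mem_uIcc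
  obtain ⟨M, hM⟩ : ∃ M : ℝ, ∀ x, b ≤ x → ‖H x‖ ≤ M := by
    obtain ⟨A₀, hA₀⟩ := eventually_atTop.1
      (ht.norm.eventually (gt_mem_nhds (lt_add_one ‖τ‖)))
    obtain ⟨M₁, hM₁⟩ := (isCompact_uIcc (a := b) (b := max b A₀)).exists_bound_of_continuousOn
      (hHc _ (le_max_left _ _))
    refine ⟨max M₁ (‖τ‖ + 1), fun x hx => ?_⟩
    rcases le_total x (max b A₀) with h1 | h1
    · exact (hM₁ x (by rw [Set.uIcc_of_le (le_max_left _ _)]; exact ⟨hx, h1⟩)).trans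
        (le_max_left _ _)
    · exact (hA₀ x ((le_max_right _ _).trans h1)).le.trans (le_max_right _ _)
  have hM0 : 0 ≤ M := (norm_nonneg _).trans (hM b le_rfl)
  refine ⟨M, fun k => ?_⟩
  have hder : ∀ x : ℝ, 0 < x →
      HasDerivAt (fun y : ℝ => ((y : ℂ) ^ k)⁻¹) (-((k : ℂ) * ((x : ℂ) ^ (k + 1))⁻¹)) x := by
    intro x hx
    have hx0 : (x : ℂ) ≠ 0 := by exact_mod_cast hx.ne'
    have h1 := ((hasDerivAt_pow k (x : ℂ)).comp_ofReal).fun_inv (pow_ne_zero k hx0)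
    refine h1.congr_deriv ?_
    rcases k with _ | k
    · simp
    · rw [Nat.add_sub_cancel]
      field_simp
      ring
  have hder' : ∀ x : ℝ, 0 < x →
      HasDerivAt (fun y : ℝ => -(y ^ k)⁻¹) ((k : ℝ) * (x ^ (k + 1))⁻¹) x := by
    intro x hx
    have h1 := ((hasDerivAt_pow k x).fun_inv (pow_ne_zero k hx.ne')).fun_neg
    refine h1.congr_deriv ?_
    rcases k with _ | k
    · simp
    · rw [Nat.add_sub_cancel]
      field_simp
      ring
  have hpos : ∀ A, b ≤ A → ∀ x ∈ Set.uIcc b A, 0 < x := by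
    intro A hA x hx
    rw [Set.uIcc_of_le hA] at hx
    exact hb.trans_le hx.1
  -- The integrand left by the integration by parts, with `H` a primitive of `h`, is dominated by
  -- `M` times the derivative of `-x^{-k}`.
  have hwc : ∀ A, b ≤ A →
      ContinuousOn (fun x : ℝ => -((k : ℂ) * ((x : ℂ) ^ (k + 1))⁻¹)) (Set.uIcc b A) := by
    intro A hA x hx
    have : (x : ℂ) ^ (k + 1) ≠ 0 := pow_ne_zero _ (by exact_mod_cast (hpos A hA x hx).ne')
    exact ContinuousAt.continuousWithinAt (by fun_prop (disch := exact this))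
  have hwr : ∀ A, b ≤ A →
      ContinuousOn (fun x : ℝ => (k : ℝ) * (x ^ (k + 1))⁻¹) (Set.uIcc b A) := by
    intro A hA x hx
    have : x ^ (k + 1) ≠ 0 := pow_ne_zero _ (hpos A hA x hx).ne'
    exact ContinuousAt.continuousWithinAt (by fun_prop (disch := exact this))
  set I : ℝ → ℂ := fun x => H x * -((k : ℂ) * ((x : ℂ) ^ (k + 1))⁻¹) with hI
  have hIc : ∀ A, b ≤ A → ContinuousOn I (Set.uIcc b A) := fun A hA => (hHc A hA).mul (hwc A hA)
  have hparts : ∀ A, b ≤ A →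
      ∫ x in b..A, h x / (x : ℂ) ^ k = H A * ((A : ℂ) ^ k)⁻¹ - ∫ x in b..A, I x := by
    intro A hA
    have key := intervalIntegral.integral_mul_deriv_eq_deriv_mul_of_hasDeriv_right
      (u := fun y : ℝ => ((y : ℂ) ^ k)⁻¹) (v := H)
      (u' := fun x : ℝ => -((k : ℂ) * ((x : ℂ) ^ (k + 1))⁻¹)) (v' := h) (a := b) (b := A)
      (fun x hx => (hder x (hpos A hA x hx)).continuousAt.continuousWithinAt) (hHc A hA)
      (fun x hx => (hder x (hpos A hA x (Set.Ioo_subset_Icc_self hx))).hasDerivWithinAt)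
      (fun x hx => by
        rw [min_eq_left hA, max_eq_right hA] at hx
        have hcx : ContinuousAt h x := hc.continuousAt (Ici_mem_nhds hx.1)
        exact (intervalIntegral.integral_hasDerivAt_right (hint x hx.1.le)
          (hc.mono Set.Ioi_subset_Ici_self |>.stronglyMeasurableAtFilter isOpen_Ioi x hx.1)
          hcx).hasDerivWithinAt)
      (hwc A hA).intervalIntegrable (hint A hA)
    have hHb : H b = 0 := intervalIntegral.integral_same
    rw [hHb, mul_zero, sub_zero] at key
    rw [mul_comm (H A)]
    calc _ = ∫ x in b..A, ((x : ℂ) ^ k)⁻¹ * h x := by simp only [div_eq_mul_inv, mul_comm]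
      _ = _ := key
      _ = _ := by simp only [hI, mul_comm]
  have hInorm : ∀ A, b ≤ A → ∫ x in b..A, ‖I x‖ ≤ M * ((b ^ k)⁻¹ - (A ^ k)⁻¹) := by
    intro A hA
    have h1 : ∫ x in b..A, M * ((k : ℝ) * (x ^ (k + 1))⁻¹) = M * ((b ^ k)⁻¹ - (A ^ k)⁻¹) := by
      rw [intervalIntegral.integral_const_mul, intervalIntegral.integral_eq_sub_of_hasDerivAt
        (fun x hx => hder' x (hpos A hA x hx)) (hwr A hA).intervalIntegrable]
      ring
    rw [← h1]
    refine intervalIntegral.integral_mono_on hA (hIc A hA).norm.intervalIntegrable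
      ((hwr A hA).const_smul M).intervalIntegrable fun x hx => ?_
    have hx0 : 0 < x := hb.trans_le hx.1
    rw [hI, norm_mul, norm_neg, norm_mul, norm_inv, norm_pow, Complex.norm_real,
      Complex.norm_natCast, Real.norm_of_nonneg hx0.le]
    gcongr
    exact hM x hx.1
  have hbound : ∀ A, b ≤ A → ‖∫ x in b..A, h x / (x : ℂ) ^ k‖ ≤ M / b ^ k := by
    intro A hA
    have hA0 : 0 < A := hb.trans_le hA
    rw [hparts A hA]
    have h1 : ‖H A * ((A : ℂ) ^ k)⁻¹‖ ≤ M * (A ^ k)⁻¹ := by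
      rw [norm_mul, norm_inv, norm_pow, Complex.norm_real, Real.norm_of_nonneg hA0.le]
      gcongr
      exact hM A hA
    have h2 := (intervalIntegral.norm_integral_le_integral_norm (f := I) (μ := volume) hA).trans
      (hInorm A hA)
    calc _ ≤ M * (A ^ k)⁻¹ + M * ((b ^ k)⁻¹ - (A ^ k)⁻¹) :=
          (norm_sub_le _ _).trans (add_le_add h1 h2)
      _ = M / b ^ k := by ring
  obtain ⟨t, ht'⟩ : ∃ t : ℂ, Tendsto (fun A => ∫ x in b..A, h x / (x : ℂ) ^ k) atTop (𝓝 t) := by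
    rcases Nat.eq_zero_or_pos k with rfl | hk
    · exact ⟨τ, by simpa using ht⟩
    have hIi : IntegrableOn I (Set.Ioi b) := by
      refine integrableOn_Ioi_of_intervalIntegral_norm_bounded (M * (b ^ k)⁻¹) b
        (l := atTop) (b := fun A => A) (fun A => ?_) tendsto_id ?_
      · rcases le_total b A with hA | hA
        · exact (intervalIntegrable_iff_integrableOn_Ioc_of_le hA).1
            (hIc A hA).intervalIntegrable
        · simp [Set.Ioc_eq_empty_of_le hA]
      · filter_upwards [eventually_ge_atTop b] with A hA
        refine (hInorm A hA).trans ?_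
        have : 0 < A := hb.trans_le hA
        gcongr
        exact sub_le_self _ (by positivity)
    have h1 := intervalIntegral_tendsto_integral_Ioi b hIi tendsto_id
    have h2 : Tendsto (fun A : ℝ => H A * ((A : ℂ) ^ k)⁻¹) atTop (𝓝 (τ * 0)) := by
      refine ht.mul ?_
      have := (tendsto_pow_atTop (α := ℝ) hk.ne').inv_tendsto_atTop
      have := (Complex.continuous_ofReal.tendsto 0).comp this
      simpa [Function.comp_def] using this
    refine ⟨_, (h2.sub h1).congr' ?_⟩
    filter_upwards [eventually_ge_atTop b] with A hA
    exact (hparts A hA).symm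
  refine ⟨t, ht', le_of_tendsto ht'.norm ?_⟩
  filter_upwards [eventually_ge_atTop b] with A hA
  exact hbound A hA

/-- A principal value over `[0, ∞)` exists once it exists on finite intervals and the tail
converges. -/
theorem exists_hasPVTop {h : ℝ → ℂ} {ω b : ℝ} {t : ℂ} (hω : 0 < ω) (hωb : ω < b)
    (H : ∀ a, ω < a → ∃ L, HasPV h ω a L)
    (hi : ∀ A, b ≤ A → IntervalIntegrable h volume b A)
    (ht : Tendsto (fun A => ∫ x in b..A, h x) atTop (𝓝 t)) : ∃ L, HasPVTop h ω L := by
  choose! P hP using H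
  refine ⟨P b + t, P, hP, (ht.const_add (P b)).congr' ?_⟩
  filter_upwards [eventually_ge_atTop b] with A hA
  exact ((hP b hωb).eq_add_integral hω hωb (hP A (hωb.trans_le hA)) (hi A hA)).symm

theorem continuousOn_div_sub {f : ℝ → ℂ} {ω b : ℝ} (hf : ContinuousOn f (Set.Ici 0)) (hω : 0 < ω)
    (hωb : ω < b) : ContinuousOn (fun x : ℝ => f x / ((x : ℂ) - (ω : ℂ))) (Set.Ici b) := by
  refine (hf.mono (Set.Ici_subset_Ici.2 (hω.trans hωb).le)).div (by fun_prop) fun x hx => ?_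
  exact sub_ne_zero.2 (by exact_mod_cast (hωb.trans_le hx).ne')

/-- If the principal value over `[0, ∞)` exists, all the tail integrals
`∫_b^∞ f(x) / ((x - ω) x^k) dx` converge. -/
theorem HasPVTop.exists_tail {f : ℝ → ℂ} {ω b : ℝ} {L Lb : ℂ} (hω : 0 < ω) (hωb : ω < b)
    (hf : ContinuousOn f (Set.Ici 0))
    (H : HasPVTop (fun x => f x / ((ω : ℂ) - (x : ℂ))) ω L)
    (Hb : HasPV (fun x => f x / ((ω : ℂ) - (x : ℂ))) ω b Lb) :
    ∃ (θ : ℕ → ℂ) (M : ℝ), θ 0 = Lb - L ∧ (∀ k, ‖θ (k + 1)‖ ≤ M / b ^ k) ∧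
      ∀ k, Tendsto (fun A => ∫ x in b..A, f x / ((x : ℂ) - (ω : ℂ)) / (x : ℂ) ^ k) atTop
        (𝓝 (θ k)) := by
  have hb : 0 < b := hω.trans hωb
  have hc := continuousOn_div_sub hf hω hωb
  have hneg : ∀ x : ℝ, f x / ((ω : ℂ) - (x : ℂ)) = -(f x / ((x : ℂ) - (ω : ℂ))) := fun x => by
    rw [← neg_sub (x : ℂ) (ω : ℂ), div_neg]
  obtain ⟨P, hP, hPt⟩ := H
  have ht : Tendsto (fun A => ∫ x in b..A, f x / ((x : ℂ) - (ω : ℂ))) atTop (𝓝 (Lb - L)) := by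
    refine (hPt.const_sub Lb).congr' ?_
    filter_upwards [eventually_ge_atTop b] with A hA
    have hi : IntervalIntegrable (fun x : ℝ => f x / ((x : ℂ) - (ω : ℂ))) volume b A :=
      ContinuousOn.intervalIntegrable (by
        rw [Set.uIcc_of_le hA]; exact hc.mono Set.Icc_subset_Ici_self)
    have hi' : IntervalIntegrable (fun x : ℝ => f x / ((ω : ℂ) - (x : ℂ))) volume b A := by
      simp only [hneg]; exact hi.neg
    rw [Hb.eq_add_integral hω hωb (hP A (hωb.trans_le hA)) hi']
    simp only [hneg, intervalIntegral.integral_neg]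
    ring
  obtain ⟨M, hM⟩ := exists_tendsto_integral_div_pow hb hc ht
  choose θ hθ hθn using hM
  refine ⟨θ, M / b, ?_, fun k => (hθn (k + 1)).trans (le_of_eq ?_), hθ⟩
  · exact tendsto_nhds_unique (by simpa using hθ 0) ht
  · rw [pow_succ, div_div, mul_comm]

theorem tendsto_integral_div_pow_succ {f : ℝ → ℂ} {ω b : ℝ} {θ : ℕ → ℂ} (hω : 0 < ω)
    (hωb : ω < b) (hf : ContinuousOn f (Set.Ici 0))
    (hθ : ∀ k, Tendsto (fun A => ∫ x in b..A, f x / ((x : ℂ) - (ω : ℂ)) / (x : ℂ) ^ k) atTop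
        (𝓝 (θ k))) (k : ℕ) :
    Tendsto (fun A => ∫ x in b..A, f x / (x : ℂ) ^ (k + 1)) atTop
      (𝓝 (θ k - ω * θ (k + 1))) := by
  have hb : 0 < b := hω.trans hωb
  refine ((hθ k).sub ((hθ (k + 1)).const_mul (ω : ℂ))).congr' ?_
  filter_upwards [eventually_ge_atTop b] with A hA
  have hi : ∀ j : ℕ, IntervalIntegrable
      (fun x : ℝ => f x / ((x : ℂ) - (ω : ℂ)) / (x : ℂ) ^ j) volume b A := by
    intro j
    refine ContinuousOn.intervalIntegrable ?_
    rw [Set.uIcc_of_le hA]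
    refine ((continuousOn_div_sub hf hω hωb).mono Set.Icc_subset_Ici_self).div (by fun_prop)
      fun x hx => pow_ne_zero _ ?_
    exact_mod_cast (hb.trans_le hx.1).ne'
  rw [← intervalIntegral.integral_const_mul,
    ← intervalIntegral.integral_sub (hi k) ((hi (k + 1)).const_mul _)]
  refine intervalIntegral.integral_congr fun x hx => ?_
  rw [Set.uIcc_of_le hA] at hx
  have hx0 : (x : ℂ) ≠ 0 := by exact_mod_cast (hb.trans_le hx.1).ne'
  have hxω : (x : ℂ) - (ω : ℂ) ≠ 0 :=
    sub_ne_zero.2 (by exact_mod_cast (hωb.trans_le hx.1).ne')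
  rw [pow_succ]
  field_simp

/-! ### The expansion on the half-line -/

/-- The tails beyond `b > ω` contribute `ω^k (θ k - ω θ (k + 1))` to the `k`-th term of the series,
where `θ k = ∫_b^∞ f(x) / ((x - ω) x^k) dx`; these telescope just as on a finite interval. -/
theorem AnalyticOnDisc.exists_expansion_top {f : ℝ → ℂ} {ρ ω : ℝ} {L : ℂ}
    (H : AnalyticOnDisc f (Set.Ici 0) ρ) (hω : 0 < ω) (hωρ : ω < ρ)
    (HL : HasPVTop (fun x => f x / ((ω : ℂ) - (x : ℂ))) ω L) :
    ∃ (p : ℕ → ℂ) (S : ℂ),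
      (∀ k : ℕ, HasFinitePartTop (fun x => f x / (x : ℂ) ^ (k + 1)) (p k)) ∧
      HasSum (fun k : ℕ => (ω : ℂ) ^ k * p k) S ∧
      HasPVTop (fun x => f x / ((ω : ℂ) - (x : ℂ))) ω (-S + f ω * (Real.log ω : ℂ)) := by
  have hωb : ω < ω + 1 := lt_add_one ω
  set b := ω + 1
  have hb : 0 < b := hω.trans hωb
  obtain ⟨p, S, hp, hS, hPV⟩ := (H.mono Set.Icc_subset_Ici_self).exists_expansion hω hωb hωρ
  obtain ⟨θ, M, hθ0, hθn, hθ⟩ := HL.exists_tail hω hωb H.continuousOn hPV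
  refine ⟨fun k => p k + (θ k - ω * θ (k + 1)), S + θ 0, fun k => ?_, ?_, ?_⟩
  · refine ⟨fun a => p k + ∫ x in b..a, f x / (x : ℂ) ^ (k + 1), fun a ha => ?_,
      (tendsto_integral_div_pow_succ hω hωb H.continuousOn hθ k).const_add (p k)⟩
    refine (hp k).change_endpoint hb ha fun u v hu huv _ => ContinuousOn.intervalIntegrable ?_
    rw [Set.uIcc_of_le huv]
    refine (H.continuousOn.mono fun x hx => hu.le.trans hx.1).div (by fun_prop)
      fun x hx => pow_ne_zero _ ?_
    exact_mod_cast (hu.trans_le hx.1).ne'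
  · refine (hS.add (hasSum_telescoping hω hωb hθn)).congr_fun fun k => ?_
    ring
  · have : -(S + θ 0) + f ω * (Real.log ω : ℂ) = L := by rw [hθ0]; ring
    rwa [this]

/-- The expansion on the half-line for `f = x^m g`. Convergence of the principal value is
assumed for `f` only; dividing by `x^m` in the tail transfers it to `g`. -/
theorem AnalyticOnDisc.exists_expansion_top_of_zero {f g : ℝ → ℂ} {ρ ω : ℝ} {L : ℂ} {m : ℕ}
    (Hf : ContinuousOn f (Set.Ici 0)) (H : AnalyticOnDisc g (Set.Ici 0) ρ) (hω : 0 < ω)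
    (hωρ : ω < ρ) (hfg : ∀ x ∈ Set.Ici (0 : ℝ), f x = (x : ℂ) ^ m * g x)
    (HL : HasPVTop (fun x => f x / ((ω : ℂ) - (x : ℂ))) ω L) :
    ∃ (q p : ℕ → ℂ) (S : ℂ),
      (∀ k : ℕ, k < m →
        HasImproperIntegral (fun x : ℝ => (x : ℂ) ^ (m - k - 1) * g x) (q k)) ∧
      (∀ k : ℕ, HasFinitePartTop (fun x => g x / (x : ℂ) ^ (k + 1)) (p k)) ∧
      HasSum (fun k : ℕ => (ω : ℂ) ^ (m + k) * p k) S ∧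
      HasPVTop (fun x => f x / ((ω : ℂ) - (x : ℂ))) ω
        (-(∑ k ∈ Finset.range m, (ω : ℂ) ^ k * q k)
          - S + (ω : ℂ) ^ m * g ω * (Real.log ω : ℂ)) := by
  have hωb : ω < ω + 1 := lt_add_one ω
  set b := ω + 1
  have hb : 0 < b := hω.trans hωb
  have Hg := H.continuousOn
  have hgc : ∀ a, ContinuousOn g (Set.Icc 0 a) := fun a => Hg.mono Set.Icc_subset_Ici_self
  obtain ⟨P₀, hP₀, -⟩ := id HL
  obtain ⟨θ, M, -, -, hθ⟩ := HL.exists_tail hω hωb Hf (hP₀ b hωb)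
  have hgPV : ∃ L', HasPVTop (fun x => g x / ((ω : ℂ) - (x : ℂ))) ω L' := by
    have hc := continuousOn_div_sub Hg hω hωb
    have hneg : ∀ x : ℝ, g x / ((ω : ℂ) - (x : ℂ)) = -(g x / ((x : ℂ) - (ω : ℂ))) := fun x => by
      rw [← neg_sub (x : ℂ) (ω : ℂ), div_neg]
    refine exists_hasPVTop (b := b) (t := -θ m) hω hωb (fun a ha => ?_) (fun A hA => ?_)
      ((hθ m).neg.congr' ?_)
    · obtain ⟨_, _, -, -, h⟩ := (H.mono Set.Icc_subset_Ici_self).exists_expansion hω ha hωρ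
      exact ⟨_, h⟩
    · simp only [hneg]
      refine (ContinuousOn.intervalIntegrable ?_).neg
      rw [Set.uIcc_of_le hA]
      exact hc.mono Set.Icc_subset_Ici_self
    · filter_upwards [eventually_ge_atTop b] with A hA
      rw [← intervalIntegral.integral_neg]
      refine intervalIntegral.integral_congr fun x hx => ?_
      rw [Set.uIcc_of_le hA] at hx
      have hx0 : (x : ℂ) ≠ 0 := by exact_mod_cast (hb.trans_le hx.1).ne'
      rw [hneg, hfg x (hb.le.trans hx.1), div_right_comm,
        mul_div_cancel_left₀ _ (pow_ne_zero m hx0)]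
  obtain ⟨L', P, hP, hPt⟩ := hgPV
  obtain ⟨p, S, hp, hS, hPV⟩ := H.exists_expansion_top hω hωρ ⟨P, hP, hPt⟩
  obtain ⟨P', hP', hPt'⟩ := hPV
  set q : ℕ → ℂ := fun k =>
    (∫ x in (0 : ℝ)..b, (x : ℂ) ^ (m - k - 1) * g x) + (θ k - ω * θ (k + 1)) with hq
  have hqt : ∀ k, k < m →
      HasImproperIntegral (fun x : ℝ => (x : ℂ) ^ (m - k - 1) * g x) (q k) := by
    intro k hk
    have hi : ∀ a, 0 < a →
        IntervalIntegrable (fun x : ℝ => (x : ℂ) ^ (m - k - 1) * g x) volume 0 a :=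
      fun a ha => intervalIntegrable_pow_mul ha.le (hgc a) _
    refine ⟨hi, ((tendsto_integral_div_pow_succ hω hωb Hf hθ k).const_add _).congr' ?_⟩
    filter_upwards [eventually_ge_atTop b] with A hA
    rw [← intervalIntegral.integral_add_adjacent_intervals (hi b hb)
      ((hi b hb).symm.trans (hi A (hb.trans_le hA)))]
    congr 1
    refine intervalIntegral.integral_congr fun x hx => ?_
    rw [Set.uIcc_of_le hA] at hx
    have hx0 : (x : ℂ) ≠ 0 := by exact_mod_cast (hb.trans_le hx.1).ne'
    have e : (x : ℂ) ^ m = (x : ℂ) ^ (k + 1) * (x : ℂ) ^ (m - k - 1) := by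
      rw [← pow_add]; congr 1; omega
    rw [hfg x (hb.le.trans hx.1), e, mul_assoc, mul_div_cancel_left₀ _ (pow_ne_zero _ hx0)]
  refine ⟨q, p, (ω : ℂ) ^ m * S, hqt, hp, ?_, ?_⟩
  · refine (hS.mul_left ((ω : ℂ) ^ m)).congr_fun fun k => ?_
    rw [pow_add, mul_assoc]
  · refine ⟨_, fun a ha => (hP' a ha).pow_mul hω ha (hgc a) m fun x hx => hfg x hx.1, ?_⟩
    have h1 := (hPt'.const_mul ((ω : ℂ) ^ m)).sub (tendsto_finsetSum (Finset.range m)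
      fun k hk => (hqt k (Finset.mem_range.1 hk)).2.const_mul ((ω : ℂ) ^ k))
    convert h1 using 2
    ring

end FinitePart

end

theorem theorem1 (f : ℝ → ℂ) :
    -- the case of a finite interval `[0, a]`
    (∀ a : ℝ, 0 < a → FinitePart.ComplexAnalytic f (Set.Icc 0 a) →
      ∀ ω : ℝ, 0 < ω → ω < a →
        ENNReal.ofReal ω < FinitePart.singularityDistance f (Set.Icc 0 a) →
        (f 0 ≠ 0 →
          ∃ (p : ℕ → ℂ) (S : ℂ),
            (∀ k : ℕ, FinitePart.HasFinitePart (fun x => f x / (x : ℂ) ^ (k + 1)) a (p k)) ∧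
            HasSum (fun k : ℕ => (ω : ℂ) ^ k * p k) S ∧
            FinitePart.HasPV (fun x => f x / ((ω : ℂ) - (x : ℂ))) ω a
              (-S + f ω * (Real.log ω : ℂ))) ∧
        (∀ (m : ℕ) (g : ℝ → ℂ), 1 ≤ m → FinitePart.ComplexAnalytic g (Set.Icc 0 a) →
          (∀ x ∈ Set.Icc 0 a, f x = (x : ℂ) ^ m * g x) → g 0 ≠ 0 →
          ∃ (p : ℕ → ℂ) (S : ℂ),
            (∀ k : ℕ, k < m →
              IntervalIntegrable (fun x : ℝ => (x : ℂ) ^ (m - k - 1) * g x) volume 0 a) ∧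
            (∀ k : ℕ, FinitePart.HasFinitePart (fun x => g x / (x : ℂ) ^ (k + 1)) a (p k)) ∧
            HasSum (fun k : ℕ => (ω : ℂ) ^ (m + k) * p k) S ∧
            FinitePart.HasPV (fun x => f x / ((ω : ℂ) - (x : ℂ))) ω a
              (-(∑ k ∈ Finset.range m,
                  (ω : ℂ) ^ k * ∫ x in (0 : ℝ)..a, (x : ℂ) ^ (m - k - 1) * g x)
                - S + (ω : ℂ) ^ m * g ω * (Real.log ω : ℂ)))) ∧
    -- the case `a = ∞`
    (FinitePart.ComplexAnalytic f (Set.Ici 0) →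
      ∀ ω : ℝ, 0 < ω →
        (ENNReal.ofReal ω < FinitePart.singularityDistance f (Set.Ici 0) ∨
          FinitePart.ExtendsToEntire f (Set.Ici 0)) →
        (∃ L : ℂ, FinitePart.HasPVTop (fun x => f x / ((ω : ℂ) - (x : ℂ))) ω L) →
        (f 0 ≠ 0 →
          ∃ (p : ℕ → ℂ) (S : ℂ),
            (∀ k : ℕ, FinitePart.HasFinitePartTop (fun x => f x / (x : ℂ) ^ (k + 1)) (p k)) ∧
            HasSum (fun k : ℕ => (ω : ℂ) ^ k * p k) S ∧
            FinitePart.HasPVTop (fun x => f x / ((ω : ℂ) - (x : ℂ))) ω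
              (-S + f ω * (Real.log ω : ℂ))) ∧
        (∀ (m : ℕ) (g : ℝ → ℂ), 1 ≤ m → FinitePart.ComplexAnalytic g (Set.Ici 0) →
          (∀ x ∈ Set.Ici (0 : ℝ), f x = (x : ℂ) ^ m * g x) → g 0 ≠ 0 →
          ∃ (q p : ℕ → ℂ) (S : ℂ),
            (∀ k : ℕ, k < m →
              FinitePart.HasImproperIntegral
                (fun x : ℝ => (x : ℂ) ^ (m - k - 1) * g x) (q k)) ∧
            (∀ k : ℕ, FinitePart.HasFinitePartTop (fun x => g x / (x : ℂ) ^ (k + 1)) (p k)) ∧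
            HasSum (fun k : ℕ => (ω : ℂ) ^ (m + k) * p k) S ∧
            FinitePart.HasPVTop (fun x => f x / ((ω : ℂ) - (x : ℂ))) ω
              (-(∑ k ∈ Finset.range m, (ω : ℂ) ^ k * q k)
                - S + (ω : ℂ) ^ m * g ω * (Real.log ω : ℂ)))) := by
  refine ⟨fun a ha _ ω hω hωa hρ => ?_, fun _ ω hω hρ hPV => ?_⟩
  · obtain ⟨ρ, hωρ, H⟩ := FinitePart.exists_analyticOnDisc_of_lt_singularityDistance hρ
    refine ⟨fun _ => H.exists_expansion hω hωa hωρ, fun m g _ hg hfg _ => ?_⟩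
    have Hg := H.of_mul_pow hg ha subset_rfl hfg
    obtain ⟨p, S, hp, hS, hPV⟩ := Hg.exists_expansion hω hωa hωρ
    refine ⟨p, (ω : ℂ) ^ m * S,
      fun k _ => FinitePart.intervalIntegrable_pow_mul ha.le Hg.continuousOn _, hp, ?_, ?_⟩
    · refine (hS.mul_left ((ω : ℂ) ^ m)).congr_fun fun k => ?_
      rw [pow_add, mul_assoc]
    · convert hPV.pow_mul hω hωa Hg.continuousOn m hfg using 1
      ring
  · obtain ⟨ρ, hωρ, H⟩ : ∃ ρ, ω < ρ ∧ FinitePart.AnalyticOnDisc f (Set.Ici 0) ρ := by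
      rcases hρ with h | h
      · exact FinitePart.exists_analyticOnDisc_of_lt_singularityDistance h
      · exact ⟨ω + 1, lt_add_one ω, h.analyticOnDisc _⟩
    obtain ⟨L, hL⟩ := hPV
    refine ⟨fun _ => H.exists_expansion_top hω hωρ hL, fun m g _ hg hfg _ => ?_⟩
    exact (H.of_mul_pow hg one_pos Set.Icc_subset_Ici_self hfg).exists_expansion_top_of_zero
      H.continuousOn hω hωρ hfg hL
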